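/- Let $N\ge 3$ and $\mathbb V=\mathbb R^{n_1\times\cdots\times n_N}$ with the Frobenius inner product and norm. For $i=3,\dots,N$ let $\mathbf U_{n_i}=l_{n_i}\mathbf W_{n_i}$ with $l_{n_i}>0$ and $\mathbf W_{n_i}$ a complex unitary $n_i\times n_i$ matrix, let $\mathfrak L(\mathcal A)=\mathcal A\times_3\mathbf U_{n_3}\times_4\cdots\times_N\mathbf U_{n_N}$ and $l=\prod_{i=3}^N l_{n_i}$. Let $\mu\ge 0$ and let $f:\mathbb R_{\ge0}\to\mathbb R_{\ge0}$ be $\mu$-weakly convex, i.e. $x\mapsto f(x)+\frac\mu2x^2$ is convex on $\mathbb R_{\ge 0}$, with $f(0)\le f(x)$ for all $x\ge 0$. Put $$\|\mathcal A\|_{f,\mathfrak L}=\frac1{l^2}\sum_{i_3,\dots,i_N}\ \sum_{j=1}^{\min\{n_1,n_2\}} f\bigl(\sigma_j(\mathfrak L(\mathcal A)(:,:,i_3,\dots,i_N))\bigr),\qquad \|\mathcal A\|_{\mathrm{GTCTV}}=\frac1{|\Gamma|}\sum_{d\in\Gamma}\|\nabla_d\mathcal A\|_{f,\mathfrak L},$$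 where $\sigma_j$ is the $j$-th singular value, $\emptyset\ne\Gamma\subseteq\{1,\dots,N\}$, and $\nabla_d\mathcal A=\mathcal A\times_d\mathbf D_{n_d}$ is the cyclic forward difference along mode $d$ ($\mathbf D_{n_d}$ is the row circulant matrix of $(-1,1,0,\dots,0)$). Let $\mathcal Y\in\mathbb V$, let $\Omega$ be a set of multi-indices, let $\mathcal P_\Omega$ be the projection that keeps the entries in $\Omega$ and sets the others to zero, and let $\delta_{\mathcal Y,\Omega}(\mathcal X)=0$ if $\mathcal P_\Omega(\mathcal X)=\mathcal P_\Omega(\mathcal Y)$ and $+\infty$ otherwise. Let $k\in(0,1)$ and let $\mathrm D_\sigma:\mathbb V\to\mathbb V$ be $k$-strictly pseudo-contractive: $$\|\mathrm D_\sigma\mathcal X-\mathrm D_\sigma\mathcal X'\|_F^2\le\|\mathcal X-\mathcal X'\|_F^2+k\,\|(\mathrm{Id}-\mathrm D_\sigma)\mathcal X-(\mathrm{Id}-\mathrm D_\sigma)\mathcal X'\|_F^2\quad\text{for all }\mathcal X,\mathcal X'\in\mathbb V.$$ Let $\alpha>0$, $\mathrm A=\partial\delta_{\mathcal Y,\Omega}$,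 $\mathrm B=\partial(\|\cdot\|_{\mathrm{GTCTV}}+2\mu\|\cdot\|_F^2)$ and $\mathrm C=\alpha(\mathrm{Id}-\mathrm D_\sigma)$, where $\partial$ is the convex subdifferential, and assume that the inclusion $$0\in\partial\delta_{\mathcal Y,\Omega}(\mathcal X)+\partial\bigl(\|\cdot\|_{\mathrm{GTCTV}}+2\mu\|\cdot\|_F^2\bigr)(\mathcal X)+\alpha(\mathrm{Id}-\mathrm D_\sigma)(\mathcal X)\tag{$*$}$$ has a solution. Let $\tau\in(0,\frac{2-2k}\alpha)$ and let $\lambda_t\in[0,1]$ ($t\ge0$) satisfy $\sum_t\lambda_t=\infty$ and $\sum_t\lambda_t^2<\infty$. Then the resolvents $\mathrm J_{\tau\mathrm A}=(\mathrm{Id}+\tau\mathrm A)^{-1}$ and $\mathrm J_{\tau\mathrm B}=(\mathrm{Id}+\tau\mathrm B)^{-1}$ are single-valued and defined everywhere, so that $$\mathrm T=\mathrm{Id}-\mathrm J_{\tau\mathrm B}+\mathrm J_{\tau\mathrm A}\circ(2\mathrm J_{\tau\mathrm B}-\mathrm{Id}-\tau\,\mathrm C\circ\mathrm J_{\tau\mathrm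 B})$$ is well defined. For every starting point $\mathcal Z_0\in\mathbb V$, the iterates of the GTCTV-DPC algorithm $$\mathcal X^{\mathrm B}_{t+1}=\mathrm J_{\tau\mathrm B}(\mathcal Z_t),\quad \mathcal X^{\mathrm A}_{t+1}=\mathcal P_{\Omega^\perp}\bigl(2\mathcal X^{\mathrm B}_{t+1}-\mathcal Z_t-\tau\alpha(\mathcal X^{\mathrm B}_{t+1}-\mathrm D_\sigma\mathcal X^{\mathrm B}_{t+1})\bigr)+\mathcal P_\Omega(\mathcal Y),\quad \mathcal Z_{t+1}=\mathcal Z_t+\lambda_t(\mathcal X^{\mathrm A}_{t+1}-\mathcal X^{\mathrm B}_{t+1})$$ (where $\Omega^\perp$ is the complement of $\Omega$) satisfy $\mathcal X^{\mathrm A}_{t+1}=\mathrm J_{\tau\mathrm A}(2\mathcal X^{\mathrm B}_{t+1}-\mathcal Z_t-\tau\mathrm C\mathcal X^{\mathrm B}_{t+1})$ and $\mathcal Z_{t+1}=(1-\lambda_t)\mathcal Z_t+\lambda_t\mathrm T\mathcal Z_t$; the sequence $(\mathcal Z_t)$ converges to a fixed point of $\mathrm T$; and $(\mathcal X^{\mathrm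 B}_t)$ and $(\mathcal X^{\mathrm A}_t)$ converge to a common solution of $(*)$. -/

import Mathlib

open Filter Topology

noncomputable section

/-! ### Convex analysis and monotone operators on a real Hilbert space -/

/-- `f` is `μ`-weakly convex on `s`: the function `x ↦ f x + (μ / 2) ‖x‖ ^ 2` is convex on `s`. -/
def WeaklyConvexOn {V : Type*} [NormedAddCommGroup V] [InnerProductSpace ℝ V]
    (s : Set V) (μ : ℝ) (f : V → ℝ) : Prop :=
  ConvexOn ℝ s (fun x => f x + μ / 2 * ‖x‖ ^ 2)

/-- The (convex) subdifferential of an extended real-valued function. -/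
def subdifferential {V : Type*} [NormedAddCommGroup V] [InnerProductSpace ℝ V]
    (f : V → EReal) (x : V) : Set V :=
  {u | ∀ y : V, ((inner ℝ (y - x) u : ℝ) : EReal) + f x ≤ f y}

/-- The resolvent `(Id + τ A)⁻¹` of a set-valued operator, as a set-valued operator. -/
def setResolvent {V : Type*} [NormedAddCommGroup V] [InnerProductSpace ℝ V]
    (τ : ℝ) (A : V → Set V) (x : V) : Set V :=
  {p | ∃ u ∈ A p, p + τ • u = x}

/-- The resolvent as a point-valued map; it is meaningful where `setResolvent τ A x` is a
singleton. -/
def resolventMap {V : Type*} [NormedAddCommGroup V] [InnerProductSpace ℝ V]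
    (τ : ℝ) (A : V → Set V) (x : V) : V :=
  Classical.epsilon (fun p => p ∈ setResolvent τ A x)

/-- `D` is `k`-strictly pseudo-contractive (for `k ∈ (0, 1)`). -/
def IsPseudoContractive {V : Type*} [NormedAddCommGroup V] [InnerProductSpace ℝ V]
    (k : ℝ) (D : V → V) : Prop :=
  ∀ x y : V, ‖D x - D y‖ ^ 2 ≤ ‖x - y‖ ^ 2 + k * ‖(x - D x) - (y - D y)‖ ^ 2

/-- The solutions of the monotone inclusion `0 ∈ A x + B x + C x`, with `C` single-valued. -/
def inclusionSolutions {V : Type*} [NormedAddCommGroup V] [InnerProductSpace ℝ V]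
    (A B : V → Set V) (C : V → V) : Set V :=
  {x | ∃ a ∈ A x, ∃ b ∈ B x, a + b + C x = 0}

/-- The Davis–Yin operator `T = Id - J_{τB} + J_{τA} ∘ (2 J_{τB} - Id - τ C ∘ J_{τB})`. -/
def davisYin {V : Type*} [NormedAddCommGroup V] [InnerProductSpace ℝ V]
    (τ : ℝ) (A B : V → Set V) (C : V → V) (z : V) : V :=
  z - resolventMap τ B z +
    resolventMap τ A ((2 : ℝ) • resolventMap τ B z - z - τ • C (resolventMap τ B z))

/-! ### Tensors -/

/-- The multi-indices of a tensor of order `N` with dimensions `n`. -/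
abbrev TensorIndex {N : ℕ} (n : Fin N → ℕ) : Type := (d : Fin N) → Fin (n d)

/-- Real tensors, with the inner product `∑ A_i B_i` and the Frobenius norm. -/
abbrev TensorSpace {N : ℕ} (n : Fin N → ℕ) : Type := EuclideanSpace ℝ (TensorIndex n)

/-- The tensor-matrix product `A ×_d F` along the mode `d` (for a square matrix `F`). -/
def modeProduct {R : Type*} [CommSemiring R] {N : ℕ} {n : Fin N → ℕ} (d : Fin N)
    (F : Matrix (Fin (n d)) (Fin (n d)) R) (A : TensorIndex n → R) : TensorIndex n → R :=
  fun i => ∑ k : Fin (n d), F (i d) k * A (Function.update i d k)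

/-- The row circulant matrix of `(-1, 1, 0, …, 0)`: `-1` on the diagonal and `1` at the cyclically
next column. -/
def differenceMatrix (m : ℕ) : Matrix (Fin m) (Fin m) ℝ :=
  fun i j => (if j = finRotate m i then 1 else 0) - (if j = i then 1 else 0)

/-- The gradient operator `∇_d` along the mode `d`. -/
def tensorGrad {N : ℕ} {n : Fin N → ℕ} (d : Fin N) (A : TensorSpace n) : TensorSpace n :=
  WithLp.toLp 2 (modeProduct d (differenceMatrix (n d)) A.ofLp)

/-- The projection `P_Ω`: keeps the entries in `Ω`, and sets all the others to zero. -/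
def tensorProj {N : ℕ} {n : Fin N → ℕ} (Ω : Finset (TensorIndex n)) (X : TensorSpace n) :
    TensorSpace n :=
  WithLp.toLp 2 (fun i => if i ∈ Ω then X i else 0)

/-- The transform `𝔏(A) = A ×_3 U_3 ×_4 ⋯ ×_N U_N` of a tensor of order `N = M + 3`. Modes are
counted from zero here, so `j.succ.succ`, `j : Fin (M + 1)`, runs through the modes from the third
on. -/
def tensorTransform {M : ℕ} {n : Fin (M + 3) → ℕ}
    (U : (j : Fin (M + 1)) → Matrix (Fin (n j.succ.succ)) (Fin (n j.succ.succ)) ℂ)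
    (A : TensorIndex n → ℂ) : TensorIndex n → ℂ :=
  (List.finRange (M + 1)).foldl (fun B j => modeProduct j.succ.succ (U j) B) A

/-- The face slice `A(:, :, r)` of a tensor of order `M + 3`. -/
def faceSlice {M : ℕ} {n : Fin (M + 3) → ℕ} (A : TensorIndex n → ℂ)
    (r : (j : Fin (M + 1)) → Fin (n j.succ.succ)) : Matrix (Fin (n 0)) (Fin (n 1)) ℂ :=
  fun a b => A (Fin.cons (α := fun d : Fin (M + 3) => Fin (n d)) a
    (Fin.cons (α := fun d : Fin (M + 2) => Fin (n d.succ)) b r))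

/-- The `f`-penalty `∑_{j = 1}^{min (p, q)} f (σ_j (A))` of the singular values of a matrix. -/
def matrixPenalty (f : ℝ → ℝ) {p q : ℕ} (A : Matrix (Fin p) (Fin q) ℂ) : ℝ :=
  ∑ j ∈ Finset.range (min p q), f ((Matrix.toEuclideanLin A).singularValues j)

/-- The tensor `f`-penalty `‖A‖_{f, 𝔏}`, for the transform matrices `U` with scale factors `l`. -/
def tensorPenalty (f : ℝ → ℝ) {M : ℕ} {n : Fin (M + 3) → ℕ}
    (U : (j : Fin (M + 1)) → Matrix (Fin (n j.succ.succ)) (Fin (n j.succ.succ)) ℂ)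
    (l : Fin (M + 1) → ℝ) (A : TensorSpace n) : ℝ :=
  1 / (∏ j, l j) ^ 2 * ∑ r : (j : Fin (M + 1)) → Fin (n j.succ.succ),
    matrixPenalty f (faceSlice (tensorTransform U (fun i => (A i : ℂ))) r)

/-- The generalized tensor correlated total variation `‖A‖_GTCTV`. -/
def gtctv (f : ℝ → ℝ) {M : ℕ} {n : Fin (M + 3) → ℕ}
    (U : (j : Fin (M + 1)) → Matrix (Fin (n j.succ.succ)) (Fin (n j.succ.succ)) ℂ)
    (l : Fin (M + 1) → ℝ) (Γ : Finset (Fin (M + 3))) (A : TensorSpace n) : ℝ :=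
  1 / (Γ.card : ℝ) * ∑ d ∈ Γ, tensorPenalty f U l (tensorGrad d A)

open Classical in
/-- The indicator function `δ_{Y, Ω}` of the constraint `P_Ω X = P_Ω Y`. -/
def dataIndicator {N : ℕ} {n : Fin N → ℕ} (Y : TensorSpace n) (Ω : Finset (TensorIndex n))
    (X : TensorSpace n) : EReal :=
  if tensorProj Ω X = tensorProj Ω Y then 0 else ⊤

/-- The operator `A = ∂ δ_{Y, Ω}`. -/
def opA {N : ℕ} {n : Fin N → ℕ} (Y : TensorSpace n) (Ω : Finset (TensorIndex n)) :
    TensorSpace n → Set (TensorSpace n) :=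
  subdifferential (dataIndicator Y Ω)

/-- The operator `B = ∂ (‖·‖_GTCTV + 2 μ ‖·‖_F ^ 2)`. -/
def opB (f : ℝ → ℝ) (μ : ℝ) {M : ℕ} {n : Fin (M + 3) → ℕ}
    (U : (j : Fin (M + 1)) → Matrix (Fin (n j.succ.succ)) (Fin (n j.succ.succ)) ℂ)
    (l : Fin (M + 1) → ℝ) (Γ : Finset (Fin (M + 3))) :
    TensorSpace n → Set (TensorSpace n) :=
  subdifferential (fun X => ((gtctv f U l Γ X + 2 * μ * ‖X‖ ^ 2 : ℝ) : EReal))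

/-- The operator `C = α (Id - D)`. -/
def opC {V : Type*} [NormedAddCommGroup V] [InnerProductSpace ℝ V] (α : ℝ) (D : V → V) : V → V :=
  fun X => α • (X - D X)

end

/-! The iteration is a relaxed Davis–Yin iteration, and the theorem rests on two facts: `B` is the
subdifferential of a finite convex function, and the residual `Id - T` is cocoercive.

Convexity: `f x + μ/2 * x^2` is convex with minimum at `0`, hence nondecreasing on `[0, ∞)`, so its
sum over the singular values is convex in the matrix (`sum_map_singularValues_convex`). The
transform multiplies the squared Frobenius norm by exactly `l^2`, so the quadratic part contributes
`μ/2 * ‖∇_d X‖^2`, which `2μ‖X‖^2` covers since `‖∇_d X‖^2 ≤ 4‖X‖^2` (`convexOn_gtctv_add`).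
Proximal points then exist, which gives the resolvent of `B`; that of `A` is an explicit projection.

Convergence: pseudo-contractivity makes `C` cocoercive with constant `β = (1-k)/(2α)`, and then `Id
- T` is cocoercive with constant `1 - τ/(4β)`, positive for the admitted `τ`
(`cocoercive_sub_davisYin`). For `τ > 2β` this does not make `T` nonexpansive. But `λ_t → 0`, which
is all that square summability is used for, so the steps are eventually short enough for Fejér
monotonicity. Divergence of `∑ λ_t` makes the residual small infinitely often, and compactness of
balls gives the limit (`tendsto_zero_of_cocoercive`). -/

noncomputable section

/-! ### Resolvents, the Davis–Yin operator and Fejér convergence -/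

section Operators

variable {V : Type*} [NormedAddCommGroup V] [InnerProductSpace ℝ V]

/-- Monotonicity of a set-valued operator. -/
def IsMonotoneOperator (A : V → Set V) : Prop :=
  ∀ ⦃x y u v : V⦄, u ∈ A x → v ∈ A y → 0 ≤ inner ℝ (x - y) (u - v)

theorem setResolvent_subsingleton {A : V → Set V} (hA : IsMonotoneOperator A) {τ : ℝ} (hτ : 0 < τ)
    {x p q : V} (hp : p ∈ setResolvent τ A x) (hq : q ∈ setResolvent τ A x) : p = q := by
  obtain ⟨u, hu, hpu⟩ := hp
  obtain ⟨v, hv, hqv⟩ := hq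
  have h := hA hu hv
  have h1 : p - q = -(τ • (u - v)) := by
    rw [smul_sub, neg_sub, sub_eq_sub_iff_add_eq_add, hpu, ← hqv, add_comm]
  have h2 : ‖u - v‖ ^ 2 ≤ 0 := by
    rw [h1, inner_neg_left, real_inner_smul_left, real_inner_self_eq_norm_sq] at h
    nlinarith
  have h3 : u - v = 0 := by
    rw [← norm_eq_zero]; nlinarith [norm_nonneg (u - v)]
  rw [h3, smul_zero, neg_zero, sub_eq_zero] at h1
  exact h1

theorem setResolvent_eq_singleton {A : V → Set V} (hA : IsMonotoneOperator A) {τ : ℝ} (hτ : 0 < τ)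
    {x : V} (hx : (setResolvent τ A x).Nonempty) :
    setResolvent τ A x = {resolventMap τ A x} := by
  have hmem : resolventMap τ A x ∈ setResolvent τ A x := Classical.epsilon_spec hx
  ext p
  exact ⟨fun hp => setResolvent_subsingleton hA hτ hp hmem, fun hp => hp ▸ hmem⟩

theorem resolventMap_eq_of_mem {τ : ℝ} {A : V → Set V} {x p : V}
    (hA : setResolvent τ A x = {resolventMap τ A x}) (hp : p ∈ setResolvent τ A x) :
    resolventMap τ A x = p := by
  rw [hA] at hp
  exact hp.symm

theorem exists_mem_resolventMap {τ : ℝ} {A : V → Set V} {x : V}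
    (hA : setResolvent τ A x = {resolventMap τ A x}) :
    ∃ u ∈ A (resolventMap τ A x), resolventMap τ A x + τ • u = x := by
  have : resolventMap τ A x ∈ setResolvent τ A x := by rw [hA]; rfl
  exact this

/-- In the expansion of `‖(p - q) + τ(u - v)‖^2` the cross term is nonnegative by monotonicity. -/
theorem norm_resolventMap_sub_le {A : V → Set V} (hA : IsMonotoneOperator A) {τ : ℝ} (hτ : 0 < τ)
    (hres : ∀ x, setResolvent τ A x = {resolventMap τ A x}) (x y : V) :
    ‖resolventMap τ A x - resolventMap τ A y‖ ≤ ‖x - y‖ := by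
  obtain ⟨u, hu, hxu⟩ := exists_mem_resolventMap (hres x)
  obtain ⟨v, hv, hyv⟩ := exists_mem_resolventMap (hres y)
  set p := resolventMap τ A x
  set q := resolventMap τ A y
  have h := hA hu hv
  have h1 : x - y = (p - q) + τ • (u - v) := by
    rw [← hxu, ← hyv, smul_sub]; abel
  have h2 : ‖x - y‖ ^ 2 = ‖p - q‖ ^ 2 + 2 * (τ * inner ℝ (p - q) (u - v)) + ‖τ • (u - v)‖ ^ 2 := by
    rw [h1, norm_add_sq_real, real_inner_smul_right]
  have h3 : 0 ≤ τ * inner ℝ (p - q) (u - v) := mul_nonneg hτ.le h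
  exact abs_le_of_sq_le_sq' (by nlinarith [sq_nonneg ‖τ • (u - v)‖]) (norm_nonneg _) |>.2

theorem continuous_resolventMap {A : V → Set V} (hA : IsMonotoneOperator A) {τ : ℝ} (hτ : 0 < τ)
    (hres : ∀ x, setResolvent τ A x = {resolventMap τ A x}) : Continuous (resolventMap τ A) :=
  (LipschitzWith.of_dist_le_mul (K := 1) fun x y => by
    simpa [dist_eq_norm] using norm_resolventMap_sub_le hA hτ hres x y).continuous

/-- A strictly pseudo-contractive map has a cocoercive displacement. -/
theorem IsPseudoContractive.cocoercive_opC {k α : ℝ} {D : V → V} (hD : IsPseudoContractive k D)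
    (hα : 0 < α) (x y : V) :
    (1 - k) / (2 * α) * ‖opC α D x - opC α D y‖ ^ 2 ≤
      inner ℝ (x - y) (opC α D x - opC α D y) := by
  have h := hD x y
  set s := (x - D x) - (y - D y) with hs
  have h1 : D x - D y = (x - y) - s := by rw [hs]; abel
  have h2 : opC α D x - opC α D y = α • s := by simp only [opC, hs, smul_sub]
  -- Expanding `‖(x - y) - s‖^2` cancels `‖x - y‖^2` and leaves `(1 - k)‖s‖^2 ≤ 2⟨x - y, s⟩`.
  rw [h1, norm_sub_sq_real] at h
  rw [h2, norm_smul, real_inner_smul_right, mul_pow, Real.norm_eq_abs, sq_abs]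
  have h3 : (1 - k) / 2 * ‖s‖ ^ 2 ≤ inner ℝ (x - y) s := by linarith
  calc (1 - k) / (2 * α) * (α ^ 2 * ‖s‖ ^ 2) = α * ((1 - k) / 2 * ‖s‖ ^ 2) := by
        field_simp
    _ ≤ _ := mul_le_mul_of_nonneg_left h3 hα.le

/-- The residual of the Davis–Yin operator is cocoercive for step sizes up to `4 β`. -/
theorem cocoercive_sub_davisYin {A B : V → Set V} {C : V → V} {τ β : ℝ}
    (hA : IsMonotoneOperator A) (hB : IsMonotoneOperator B) (hτ : 0 < τ) (hβ : 0 < β)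
    (hC : ∀ x y, β * ‖C x - C y‖ ^ 2 ≤ inner ℝ (x - y) (C x - C y))
    (hresA : ∀ x, setResolvent τ A x = {resolventMap τ A x})
    (hresB : ∀ x, setResolvent τ B x = {resolventMap τ B x}) (x y : V) :
    (1 - τ / (4 * β)) * ‖(x - davisYin τ A B C x) - (y - davisYin τ A B C y)‖ ^ 2 ≤
      inner ℝ (x - y) ((x - davisYin τ A B C x) - (y - davisYin τ A B C y)) := by
  simp only [davisYin]
  obtain ⟨b, hb, hxb⟩ := exists_mem_resolventMap (hresB x)
  obtain ⟨b', hb', hyb⟩ := exists_mem_resolventMap (hresB y)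
  set p := resolventMap τ B x
  set p' := resolventMap τ B y
  obtain ⟨a, ha, hxa⟩ := exists_mem_resolventMap (hresA ((2 : ℝ) • p - x - τ • C p))
  obtain ⟨a', ha', hya⟩ := exists_mem_resolventMap (hresA ((2 : ℝ) • p' - y - τ • C p'))
  set q := resolventMap τ A ((2 : ℝ) • p - x - τ • C p)
  set q' := resolventMap τ A ((2 : ℝ) • p' - y - τ • C p')
  have hmB := mul_nonneg hτ.le (hB hb hb')
  have hmA := mul_nonneg hτ.le (hA ha ha')
  have hcC := mul_le_mul_of_nonneg_left (hC p p') hτ.le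
  set r := (p - p') - (q - q') with hr
  have e1 : (x - (x - p + q)) - (y - (y - p' + q')) = r := by rw [hr]; abel
  have e2 : x - y = (p - p') + τ • (b - b') := by rw [← hxb, ← hyb, smul_sub]; abel
  have e3 : q - q' = (p - p') - r := by rw [hr]; abel
  have e4 : τ • (a - a') = r - τ • (b - b') - τ • (C p - C p') := by
    have h1 : τ • a = (2 : ℝ) • p - x - τ • C p - q := by rw [← hxa]; abel
    have h2 : τ • a' = (2 : ℝ) • p' - y - τ • C p' - q' := by rw [← hya]; abel
    rw [smul_sub, h1, h2, hr]
    nth_rewrite 1 [← hxb]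
    nth_rewrite 1 [← hyb]
    module
  rw [e1, e2]
  rw [← real_inner_smul_right, e4, e3] at hmA
  set P := p - p'
  set b₁ := b - b'
  set c := C p - C p'
  simp only [inner_sub_left, inner_sub_right, inner_add_left, real_inner_smul_left,
    real_inner_smul_right] at hmA ⊢
  rw [real_inner_self_eq_norm_sq] at hmA
  rw [real_inner_comm b₁ r] at hmA
  have h5 : -(τ * inner ℝ r c) ≤ τ * (‖r‖ * ‖c‖) := by
    have := neg_le_of_abs_le (abs_real_inner_le_norm r c)
    nlinarith
  -- Young's inequality, weighted so that `τβ‖c‖^2` is absorbed by the cocoercivity of `C`; the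
  -- price `τ/(4β)‖r‖^2` is the loss in the final constant.
  have h6 : τ * (‖r‖ * ‖c‖) ≤ τ * (β * ‖c‖ ^ 2) + τ / (4 * β) * ‖r‖ ^ 2 := by
    have : τ * (β * ‖c‖ ^ 2) + τ / (4 * β) * ‖r‖ ^ 2 - τ * (‖r‖ * ‖c‖) =
        τ * β * (‖c‖ - ‖r‖ / (2 * β)) ^ 2 := by field_simp; ring
    have h7 : 0 ≤ τ * β * (‖c‖ - ‖r‖ / (2 * β)) ^ 2 := by positivity
    linarith
  have h5' : τ * inner ℝ r c ≤ τ * (‖r‖ * ‖c‖) :=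
    mul_le_mul_of_nonneg_left (real_inner_le_norm r c) hτ.le
  linarith

/-- At a fixed point both resolvents return the same `p`, and adding their defining equations gives
`τ(a + b + C p) = 0`. -/
theorem mem_inclusionSolutions_of_davisYin_eq {A B : V → Set V} {C : V → V} {τ : ℝ} (hτ : 0 < τ)
    (hresA : ∀ x, setResolvent τ A x = {resolventMap τ A x})
    (hresB : ∀ x, setResolvent τ B x = {resolventMap τ B x}) {z : V}
    (hz : davisYin τ A B C z = z) : resolventMap τ B z ∈ inclusionSolutions A B C := by
  obtain ⟨b, hb, hzb⟩ := exists_mem_resolventMap (hresB z)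
  simp only [davisYin] at hz
  set p := resolventMap τ B z
  obtain ⟨a, ha, hza⟩ := exists_mem_resolventMap (hresA ((2 : ℝ) • p - z - τ • C p))
  set q := resolventMap τ A ((2 : ℝ) • p - z - τ • C p)
  have hq : q = p := by
    have : q = (z - p + q) - z + p := by abel
    rw [this, hz]; abel
  rw [hq] at ha hza
  refine ⟨a, ha, b, hb, ?_⟩
  have h : τ • (a + b + C p) = 0 := by
    have h1 : τ • (a + b + C p) = (p + τ • a) - ((2 : ℝ) • p - (p + τ • b) - τ • C p) := by module
    rw [h1, hza, hzb, sub_self]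
  exact (smul_eq_zero.mp h).resolve_left hτ.ne'

/-- A solution `x` with `b ∈ B x` is encoded by the fixed point `x + τ b`. -/
theorem exists_davisYin_eq {A B : V → Set V} {C : V → V} {τ : ℝ}
    (hresA : ∀ x, setResolvent τ A x = {resolventMap τ A x})
    (hresB : ∀ x, setResolvent τ B x = {resolventMap τ B x})
    (h : (inclusionSolutions A B C).Nonempty) : ∃ z, davisYin τ A B C z = z := by
  obtain ⟨x, a, ha, b, hb, habc⟩ := h
  refine ⟨x + τ • b, ?_⟩
  have h1 : resolventMap τ B (x + τ • b) = x := resolventMap_eq_of_mem (hresB _) ⟨b, hb, rfl⟩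
  have h2 : resolventMap τ A ((2 : ℝ) • x - (x + τ • b) - τ • C x) = x := by
    refine resolventMap_eq_of_mem (hresA _) ⟨a, ha, ?_⟩
    have : x + τ • a - ((2 : ℝ) • x - (x + τ • b) - τ • C x) = τ • (a + b + C x) := by module
    rw [← sub_eq_zero, this, habc, smul_zero]
  simp only [davisYin, h1, h2]
  abel

/-- Convergence of `z (t + 1) = z t - lam t • R (z t)` to a zero of a cocoercive operator `R`. -/
theorem tendsto_zero_of_cocoercive [ProperSpace V] {R : V → V} {c : ℝ} (hc : 0 < c)
    (hR : ∀ x y, c * ‖R x - R y‖ ^ 2 ≤ inner ℝ (x - y) (R x - R y)) (hzero : ∃ w, R w = 0)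
    {lam : ℕ → ℝ} (hlam : ∀ t, 0 ≤ lam t)
    (hlam_sum : Tendsto (fun m => ∑ t ∈ Finset.range m, lam t) atTop atTop)
    (hlam_zero : Tendsto lam atTop (𝓝 0)) {z : ℕ → V}
    (hz : ∀ t, z (t + 1) = z t - lam t • R (z t)) :
    Continuous R ∧ ∃ w, R w = 0 ∧ Tendsto z atTop (𝓝 w) := by
  have hcont : Continuous R := by
    refine (LipschitzWith.of_dist_le_mul (K := (1 / c).toNNReal) fun x y => ?_).continuous
    rw [dist_eq_norm, dist_eq_norm, Real.coe_toNNReal _ (by positivity)]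
    rcases eq_or_lt_of_le (norm_nonneg (R x - R y)) with h0 | h0
    · rw [← h0]; positivity
    have h1 := (hR x y).trans (real_inner_le_norm _ _)
    rw [one_div, inv_mul_eq_div, le_div_iff₀ hc]
    nlinarith
  refine ⟨hcont, ?_⟩
  -- From `t₀` on `lam t < c`, so half of the decrease `2 c lam t ‖R (z t)‖^2` survives the
  -- second-order term `lam t ^ 2 ‖R (z t)‖^2`.
  obtain ⟨t₀, ht₀⟩ := eventually_atTop.mp (hlam_zero.eventually_lt_const hc)
  have fejer : ∀ w, R w = 0 → ∀ t, t₀ ≤ t →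
      ‖z (t + 1) - w‖ ^ 2 + c * (lam t * ‖R (z t)‖ ^ 2) ≤ ‖z t - w‖ ^ 2 := by
    intro w hw t ht
    have h1 := hR (z t) w
    rw [hw, sub_zero] at h1
    have h2 : z (t + 1) - w = (z t - w) - lam t • R (z t) := by rw [hz]; abel
    rw [h2, norm_sub_sq_real, real_inner_smul_right, norm_smul, mul_pow, Real.norm_eq_abs, sq_abs]
    have h3 := mul_le_mul_of_nonneg_left h1 (hlam t)
    have h4 : lam t ^ 2 * ‖R (z t)‖ ^ 2 ≤ c * (lam t * ‖R (z t)‖ ^ 2) := by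
      have := mul_le_mul_of_nonneg_right (mul_le_mul_of_nonneg_right (ht₀ t ht).le (hlam t))
        (sq_nonneg ‖R (z t)‖)
      nlinarith
    nlinarith
  have mono : ∀ w, R w = 0 → ∀ s t, t₀ ≤ s → s ≤ t → ‖z t - w‖ ^ 2 ≤ ‖z s - w‖ ^ 2 := by
    intro w hw s t hs hst
    induction t, hst using Nat.le_induction with
    | base => exact le_rfl
    | succ t hst ih =>
      have := fejer w hw t (hs.trans hst)
      have h' : 0 ≤ c * (lam t * ‖R (z t)‖ ^ 2) :=
        mul_nonneg hc.le (mul_nonneg (hlam t) (sq_nonneg _))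
      linarith
  obtain ⟨w₀, hw₀⟩ := hzero
  have freq : ∀ ε : ℝ, 0 < ε → ∃ᶠ t in atTop, ‖R (z t)‖ < ε := by
    intro ε hε
    by_contra hcon
    rw [not_frequently] at hcon
    obtain ⟨t₁, ht₁⟩ := eventually_atTop.mp (hcon.and (eventually_ge_atTop t₀))
    -- If the residual stayed above `ε`, the telescoped Fejér inequality would bound the divergent
    -- partial sums of `lam`.
    have key : ∀ m, t₁ ≤ m → c * ε ^ 2 * (∑ t ∈ Finset.range m, lam t) + ‖z m - w₀‖ ^ 2 ≤
        c * ε ^ 2 * (∑ t ∈ Finset.range t₁, lam t) + ‖z t₁ - w₀‖ ^ 2 := by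
      intro m hm
      induction m, hm using Nat.le_induction with
      | base => exact le_rfl
      | succ m hm ih =>
        rw [Finset.sum_range_succ]
        have h1 := fejer w₀ hw₀ m (ht₁ m hm).2
        have h2 : ε ≤ ‖R (z m)‖ := not_lt.mp (ht₁ m hm).1
        have h3 : ε ^ 2 ≤ ‖R (z m)‖ ^ 2 := pow_le_pow_left₀ hε.le h2 2
        have h4 := mul_le_mul_of_nonneg_left h3 (mul_nonneg hc.le (hlam m))
        nlinarith
    obtain ⟨m, hm, hm'⟩ := ((hlam_sum.const_mul_atTop (r := c * ε ^ 2) (by positivity)).eventually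
      (eventually_gt_atTop (c * ε ^ 2 * (∑ t ∈ Finset.range t₁, lam t) + ‖z t₁ - w₀‖ ^ 2))).and
        (eventually_ge_atTop t₁) |>.exists
    have := key m hm'
    nlinarith [sq_nonneg ‖z m - w₀‖]
  obtain ⟨φ, hφ, hφR⟩ := extraction_forall_of_frequently
    (P := fun n t => ‖R (z t)‖ < 1 / ((n : ℝ) + 1) ∧ t₀ ≤ t)
    (fun n => (freq _ (by positivity)).and_eventually (eventually_ge_atTop t₀))
  have hbdd : ∀ n, z (φ n) ∈ Metric.closedBall w₀ ‖z t₀ - w₀‖ := by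
    intro n
    rw [mem_closedBall_iff_norm]
    exact abs_le_of_sq_le_sq' (mono w₀ hw₀ t₀ (φ n) le_rfl (hφR n).2) (norm_nonneg _) |>.2
  obtain ⟨w, -, ψ, hψ, hψw⟩ := tendsto_subseq_of_bounded Metric.isBounded_closedBall hbdd
  have hRw : R w = 0 := by
    have h1 : Tendsto (fun n => R (z (φ (ψ n)))) atTop (𝓝 (R w)) := (hcont.tendsto w).comp hψw
    have h2 : Tendsto (fun n => R (z (φ n))) atTop (𝓝 0) :=
      squeeze_zero_norm (fun n => (hφR n).1.le) tendsto_one_div_add_atTop_nhds_zero_nat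
    exact tendsto_nhds_unique h1 (h2.comp hψ.tendsto_atTop)
  refine ⟨w, hRw, ?_⟩
  rw [Metric.tendsto_atTop]
  intro ε hε
  -- The distance to the zero `w` is nonincreasing, so one close index of the subsequence controls
  -- the whole tail.
  obtain ⟨n, hn⟩ := (Metric.tendsto_atTop.mp hψw) ε hε
  refine ⟨φ (ψ n), fun t ht => ?_⟩
  have h1 := hn n le_rfl
  simp only [Function.comp] at h1
  rw [dist_eq_norm] at h1 ⊢
  exact (abs_le_of_sq_le_sq' (mono w hRw _ t (hφR (ψ n)).2 ht) (norm_nonneg _)).2.trans_lt h1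

/-! ### Subdifferentials of finite functions and proximal points -/

theorem mem_subdifferential_coe {F : V → ℝ} {x u : V} :
    u ∈ subdifferential (fun x => (F x : EReal)) x ↔ ∀ y, inner ℝ (y - x) u + F x ≤ F y := by
  simp only [subdifferential, Set.mem_ofPred_eq, ← EReal.coe_add, EReal.coe_le_coe_iff]

theorem isMonotoneOperator_subdifferential_coe (F : V → ℝ) :
    IsMonotoneOperator (subdifferential (fun x => (F x : EReal))) := by
  intro x y u v hu hv
  have h1 := mem_subdifferential_coe.mp hu y
  have h2 := mem_subdifferential_coe.mp hv x
  have h3 : inner ℝ (y - x) u = -inner ℝ (x - y) u := by rw [← inner_neg_left, neg_sub]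
  rw [inner_sub_right]
  linarith

/-- Existence of the proximal point of a finite nonnegative convex function. -/
theorem setResolvent_subdifferential_coe_nonempty [FiniteDimensional ℝ V] {F : V → ℝ}
    (hF : ConvexOn ℝ Set.univ F) (hF0 : ∀ x, 0 ≤ F x) {τ : ℝ} (hτ : 0 < τ) (x : V) :
    (setResolvent τ (subdifferential (fun x => (F x : EReal))) x).Nonempty := by
  have hFc : Continuous F := hF.locallyLipschitz.continuous
  have : ProperSpace V := FiniteDimensional.proper ℝ V
  have htop : Tendsto (fun p => F p + 1 / (2 * τ) * ‖p - x‖ ^ 2) (cocompact V) atTop := by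
    have h1 : Tendsto (fun p => ‖p - x‖) (cocompact V) atTop := by
      simpa [dist_eq_norm] using tendsto_dist_right_cocompact_atTop x
    have h2 : Tendsto (fun p => 1 / (2 * τ) * ‖p - x‖ ^ 2) (cocompact V) atTop :=
      ((tendsto_pow_atTop two_ne_zero).comp h1).const_mul_atTop (by positivity)
    exact tendsto_atTop_mono (fun p => by linarith [hF0 p]) h2
  obtain ⟨p, hp⟩ := Continuous.exists_forall_le
    (f := fun p => F p + 1 / (2 * τ) * ‖p - x‖ ^ 2) (by fun_prop) htop
  refine ⟨p, τ⁻¹ • (x - p), mem_subdifferential_coe.mpr fun y => ?_, ?_⟩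
  · rw [real_inner_smul_right]
    -- Comparing the minimiser `p` with `p + s(y - p)` and dividing by `s` leaves the subgradient
    -- inequality with an error of order `s`, which vanishes as `s → 0`.
    have hs : ∀ s : ℝ, 0 < s → s ≤ 1 →
        0 ≤ (F y - F p - τ⁻¹ * inner ℝ (y - p) (x - p)) + s * (1 / (2 * τ) * ‖y - p‖ ^ 2) := by
      intro s hs0 hs1
      have h1 := hp (p + s • (y - p))
      have h2 := hF.2 (Set.mem_univ p) (Set.mem_univ y) (sub_nonneg.mpr hs1) hs0.le (by ring)
      have h3 : (1 - s) • p + s • y = p + s • (y - p) := by module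
      rw [h3, smul_eq_mul, smul_eq_mul] at h2
      have h4 : p + s • (y - p) - x = s • (y - p) - (x - p) := by abel
      rw [h4, norm_sub_rev p x, norm_sub_sq_real (s • (y - p)), real_inner_smul_left, norm_smul,
        mul_pow, Real.norm_eq_abs, sq_abs] at h1
      have h5 : 0 ≤ s * ((F y - F p - τ⁻¹ * inner ℝ (y - p) (x - p)) +
          s * (1 / (2 * τ) * ‖y - p‖ ^ 2)) := by
        have h6 : τ⁻¹ = 2 * (1 / (2 * τ)) := by field_simp
        rw [h6]
        linarith
      exact nonneg_of_mul_nonneg_right h5 hs0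
    have hlim : Tendsto (fun s : ℝ => (F y - F p - τ⁻¹ * inner ℝ (y - p) (x - p)) +
        s * (1 / (2 * τ) * ‖y - p‖ ^ 2)) (𝓝[>] 0)
        (𝓝 ((F y - F p - τ⁻¹ * inner ℝ (y - p) (x - p)) + 0 * (1 / (2 * τ) * ‖y - p‖ ^ 2))) :=
      (Continuous.tendsto (by fun_prop) 0).mono_left nhdsWithin_le_nhds
    have h7 := ge_of_tendsto hlim (by
      filter_upwards [Ioc_mem_nhdsGT (zero_lt_one' ℝ)] with s hs' using hs s hs'.1 hs'.2)
    linarith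
  · rw [smul_smul, mul_inv_cancel₀ hτ.ne', one_smul]; abel

end Operators

/-! ### Convexity of sums over singular values -/

section SingularValues

open Module

variable {𝕜 : Type*} [RCLike 𝕜]
  {E : Type*} [NormedAddCommGroup E] [InnerProductSpace 𝕜 E] [FiniteDimensional 𝕜 E]
  {F : Type*} [NormedAddCommGroup F] [InnerProductSpace 𝕜 F] [FiniteDimensional 𝕜 F]

/-- A singular value decomposition. The left singular vectors of the singular value zero are taken
to be zero, so that the family `u` is orthonormal only up to its zero entries. -/
theorem exists_singularValueDecomposition (T : E →ₗ[𝕜] F) {n : ℕ} (hn : finrank 𝕜 E = n) :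
    ∃ (v : OrthonormalBasis (Fin n) 𝕜 E) (u : Fin n → F),
      (∀ j, T (v j) = ((T.singularValues j : ℝ) : 𝕜) • u j) ∧
      (∀ j, inner 𝕜 (u j) (T (v j)) = ((T.singularValues j : ℝ) : 𝕜)) ∧
      (∀ j, ‖u j‖ ≤ 1) ∧ (∀ x, ∑ j, ‖inner 𝕜 (u j) x‖ ^ 2 ≤ ‖x‖ ^ 2) := by
  set v := T.isSymmetric_adjoint_comp_self.eigenvectorBasis hn with hv
  have hin : ∀ i j, inner 𝕜 (T (v i)) (T (v j)) =
      if i = j then (((T.singularValues j) ^ 2 : ℝ) : 𝕜) else 0 := by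
    intro i j
    rw [← LinearMap.adjoint_inner_right, ← LinearMap.comp_apply, hv,
      LinearMap.IsSymmetric.apply_eigenvectorBasis, inner_smul_right,
      OrthonormalBasis.inner_eq_ite, ← T.sq_singularValues_fin hn]
    split_ifs <;> simp
  have hu : ∀ i j : Fin n, T.singularValues i ≠ 0 → T.singularValues j ≠ 0 →
      inner 𝕜 (((T.singularValues i : ℝ) : 𝕜)⁻¹ • T (v i))
        (((T.singularValues j : ℝ) : 𝕜)⁻¹ • T (v j)) = if i = j then (1 : 𝕜) else 0 := by
    intro i j hi hj
    rw [inner_smul_left, inner_smul_right, hin]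
    split_ifs with hij
    · subst hij
      have : ((T.singularValues i : ℝ) : 𝕜) ≠ 0 := by exact_mod_cast hi
      rw [← RCLike.ofReal_inv, RCLike.conj_ofReal]
      push_cast
      field_simp
    · simp
  set u : Fin n → F := fun j => ((T.singularValues j : ℝ) : 𝕜)⁻¹ • T (v j) with hudef
  -- Since `0⁻¹ = 0`, the vector `u j` vanishes for a zero singular value; Bessel's inequality is
  -- applied to the others only.
  have hu0 : ∀ j : Fin n, T.singularValues j = 0 → u j = 0 := fun j hj => by simp [hudef, hj]
  refine ⟨v, u, fun j => ?_, fun j => ?_, fun j => ?_, fun x => ?_⟩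
  · by_cases hj : T.singularValues j = 0
    · have := hin j j
      rw [if_pos rfl, hj] at this
      rw [hj]
      simpa using this
    · have : ((T.singularValues j : ℝ) : 𝕜) ≠ 0 := by exact_mod_cast hj
      rw [hudef, smul_smul, mul_inv_cancel₀ this, one_smul]
  · rw [hudef, inner_smul_left, hin, if_pos rfl, ← RCLike.ofReal_inv, RCLike.conj_ofReal,
      ← RCLike.ofReal_mul]
    by_cases hj : T.singularValues j = 0
    · simp [hj]
    · congr 1; field_simp
  · by_cases hj : T.singularValues j = 0
    · simp [hu0 j hj]
    · have := hu j j hj hj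
      rw [if_pos rfl, inner_self_eq_norm_sq_to_K] at this
      have h2 : ‖((T.singularValues j : ℝ) : 𝕜)⁻¹ • T (v j)‖ ^ 2 = 1 := by
        exact_mod_cast this
      exact (sq_le_one_iff₀ (norm_nonneg _)).mp h2.le
  · classical
    have ho : Orthonormal 𝕜 (fun j : {j : Fin n // T.singularValues j ≠ 0} => u j) := by
      rw [orthonormal_iff_ite]
      intro i j
      rw [hudef, hu i j i.2 j.2]
      simp only [Subtype.ext_iff]
    calc ∑ j, ‖inner 𝕜 (u j) x‖ ^ 2
        = ∑ j ∈ {j : Fin n | T.singularValues j ≠ 0}, ‖inner 𝕜 (u j) x‖ ^ 2 := by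
          refine (Finset.sum_filter_of_ne (p := fun j : Fin n => T.singularValues j ≠ 0)
            fun j _ hj h0 => hj ?_).symm
          simp [hu0 j h0]
      _ = ∑ j : {j : Fin n // T.singularValues j ≠ 0}, ‖inner 𝕜 (u j) x‖ ^ 2 := by
          rw [← Finset.sum_subtype_eq_sum_filter, Finset.subtype_univ]
      _ ≤ ‖x‖ ^ 2 := ho.sum_inner_products_le x

theorem ConvexOn.monotoneOn_Ici_of_forall_le {g : ℝ → ℝ} (hg : ConvexOn ℝ (Set.Ici 0) g)
    (hg0 : ∀ x, 0 ≤ x → g 0 ≤ g x) : MonotoneOn g (Set.Ici 0) := by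
  intro x hx y hy hxy
  rcases eq_or_lt_of_le (Set.mem_Ici.mp hy) with h0 | h0
  · have : x = y := le_antisymm hxy (h0 ▸ hx)
    rw [this]
  have h1 : x / y ≤ 1 := (div_le_one h0).mpr hxy
  have h2 : 0 ≤ x / y := div_nonneg hx h0.le
  have h := hg.2 (Set.mem_Ici.mpr le_rfl) hy (sub_nonneg.mpr h1) h2 (by ring)
  simp only [smul_eq_mul, mul_zero, zero_add, div_mul_cancel₀ x h0.ne'] at h
  have := hg0 y hy
  nlinarith

/-- Jensen's inequality for weights of sum at most one. -/
theorem ConvexOn.map_sum_le_of_sum_le_one {ι : Type*} {s : Finset ι} {h : ℝ → ℝ}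
    (hh : ConvexOn ℝ (Set.Ici 0) h) (h0 : h 0 = 0) {w x : ι → ℝ} (hw : ∀ i ∈ s, 0 ≤ w i)
    (hw1 : ∑ i ∈ s, w i ≤ 1) (hx : ∀ i ∈ s, 0 ≤ x i) :
    h (∑ i ∈ s, w i * x i) ≤ ∑ i ∈ s, w i * h (x i) := by
  -- The missing mass `1 - ∑ w i` is placed at the extra point `0`, where `h` vanishes.
  have := hh.map_sum_le (t := Finset.insertNone s) (w := fun o => o.elim (1 - ∑ i ∈ s, w i) w)
    (p := fun o => o.elim 0 x)
    (by
      intro o ho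
      cases o with
      | none => exact sub_nonneg.mpr hw1
      | some i => exact hw i (by simpa using ho))
    (by simp)
    (by
      intro o ho
      cases o with
      | none => exact Set.mem_Ici.mpr le_rfl
      | some i => exact hx i (by simpa using ho))
  simpa [h0] using this

/-- The diagonal of a matrix in two orthonormal families is dominated by its singular values. -/
theorem sum_map_norm_inner_le_sum_singularValues (T : E →ₗ[𝕜] F) {n : ℕ} (hn : finrank 𝕜 E = n)
    {h : ℝ → ℝ} (hh : ConvexOn ℝ (Set.Ici 0) h) (h0 : h 0 = 0) (hpos : ∀ x, 0 ≤ x → 0 ≤ h x)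
    (v : OrthonormalBasis (Fin n) 𝕜 E) {u : Fin n → F} (hu1 : ∀ j, ‖u j‖ ≤ 1)
    (hu : ∀ x, ∑ j, ‖inner 𝕜 (u j) x‖ ^ 2 ≤ ‖x‖ ^ 2) :
    ∑ j, h ‖inner 𝕜 (u j) (T (v j))‖ ≤ ∑ k : Fin n, h (T.singularValues k) := by
  obtain ⟨y, x, hTy, -, hx1, hx⟩ := exists_singularValueDecomposition T hn
  have hmono := hh.monotoneOn_Ici_of_forall_le (by simpa [h0] using hpos)
  -- By the AM-GM inequality these weights dominate `‖⟨u j, x k⟩‖ * ‖⟨y k, v j⟩‖`, and Bessel and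
  -- Parseval make them doubly substochastic.
  set w : Fin n → Fin n → ℝ := fun j k =>
    (‖inner 𝕜 (u j) (x k)‖ ^ 2 + ‖inner 𝕜 (y k) (v j)‖ ^ 2) / 2 with hw
  have hw0 : ∀ j k, 0 ≤ w j k := fun j k => by positivity
  have hrow : ∀ j, ∑ k, w j k ≤ 1 := by
    intro j
    rw [hw, ← Finset.sum_div, Finset.sum_add_distrib, y.sum_sq_norm_inner_right, v.norm_eq_one]
    have h1 := hx (u j)
    simp_rw [norm_inner_symm (x _) (u j)] at h1
    have h2 : ‖u j‖ ^ 2 ≤ 1 := pow_le_one₀ (norm_nonneg _) (hu1 j)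
    linarith
  have hcol : ∀ k, ∑ j, w j k ≤ 1 := by
    intro k
    rw [hw, ← Finset.sum_div, Finset.sum_add_distrib, v.sum_sq_norm_inner_left, y.norm_eq_one]
    have h1 := hu (x k)
    have h2 : ‖x k‖ ^ 2 ≤ 1 := pow_le_one₀ (norm_nonneg _) (hx1 k)
    linarith
  have hentry : ∀ j, ‖inner 𝕜 (u j) (T (v j))‖ ≤ ∑ k, w j k * T.singularValues k := by
    intro j
    have h1 : T (v j) = ∑ k, inner 𝕜 (y k) (v j) • ((T.singularValues k : ℝ) : 𝕜) • x k := by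
      conv_lhs => rw [← y.sum_repr' (v j), map_sum]
      simp_rw [map_smul, hTy]
    rw [h1, inner_sum]
    refine (norm_sum_le _ _).trans (Finset.sum_le_sum fun k _ => ?_)
    rw [inner_smul_right, inner_smul_right, norm_mul, norm_mul, RCLike.norm_ofReal,
      abs_of_nonneg (T.singularValues_nonneg k)]
    have h2 := two_mul_le_add_sq ‖inner 𝕜 (u j) (x k)‖ ‖inner 𝕜 (y k) (v j)‖
    have h3 : ‖inner 𝕜 (y k) (v j)‖ * ‖inner 𝕜 (u j) (x k)‖ ≤ w j k := by
      rw [hw]; linarith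
    nlinarith [T.singularValues_nonneg k]
  calc ∑ j, h ‖inner 𝕜 (u j) (T (v j))‖
      ≤ ∑ j, ∑ k, w j k * h (T.singularValues k) := by
        refine Finset.sum_le_sum fun j _ => ?_
        have hs : 0 ≤ ∑ k, w j k * T.singularValues k :=
          Finset.sum_nonneg fun k _ => mul_nonneg (hw0 j k) (T.singularValues_nonneg k)
        refine (hmono (norm_nonneg _) hs (hentry j)).trans ?_
        exact hh.map_sum_le_of_sum_le_one h0 (fun k _ => hw0 j k) (hrow j)
          (fun k _ => T.singularValues_nonneg k)
    _ = ∑ k, (∑ j, w j k) * h (T.singularValues k) := by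
        rw [Finset.sum_comm]
        simp_rw [Finset.sum_mul]
    _ ≤ ∑ k : Fin n, h (T.singularValues k) :=
        Finset.sum_le_sum fun k _ =>
          mul_le_of_le_one_left (hpos _ (T.singularValues_nonneg k)) (hcol k)

/-- In the singular vectors of the combination `R` itself, `σ_j(R)` is a diagonal entry, so it is
bounded by the convex combination of the diagonals of `S` and `T`; these are dominated by the
singular values of `S` and `T`. -/
theorem sum_map_singularValues_convex {n : ℕ} (hn : finrank 𝕜 E = n)
    {h : ℝ → ℝ} (hh : ConvexOn ℝ (Set.Ici 0) h) (h0 : h 0 = 0) (hpos : ∀ x, 0 ≤ x → 0 ≤ h x)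
    (S T : E →ₗ[𝕜] F) {a b : ℝ} (ha : 0 ≤ a) (hb : 0 ≤ b) (hab : a + b = 1) :
    ∑ k : Fin n, h (((a : 𝕜) • S + (b : 𝕜) • T).singularValues k) ≤
      a * ∑ k : Fin n, h (S.singularValues k) + b * ∑ k : Fin n, h (T.singularValues k) := by
  set R := (a : 𝕜) • S + (b : 𝕜) • T with hR
  obtain ⟨v, u, -, huv, hu1, hu⟩ := exists_singularValueDecomposition R hn
  have hmono := hh.monotoneOn_Ici_of_forall_le (by simpa [h0] using hpos)
  have key : ∀ j : Fin n, h (R.singularValues j) ≤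
      a * h ‖inner 𝕜 (u j) (S (v j))‖ + b * h ‖inner 𝕜 (u j) (T (v j))‖ := by
    intro j
    have h1 : R.singularValues j ≤
        a * ‖inner 𝕜 (u j) (S (v j))‖ + b * ‖inner 𝕜 (u j) (T (v j))‖ := by
      have h2 : R.singularValues j = ‖inner 𝕜 (u j) (R (v j))‖ := by
        rw [huv, RCLike.norm_ofReal, abs_of_nonneg (R.singularValues_nonneg j)]
      rw [h2, hR, LinearMap.add_apply, LinearMap.smul_apply, LinearMap.smul_apply, inner_add_right,
        inner_smul_right, inner_smul_right]
      refine (norm_add_le _ _).trans (le_of_eq ?_)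
      rw [norm_mul, norm_mul, RCLike.norm_ofReal, RCLike.norm_ofReal, abs_of_nonneg ha,
        abs_of_nonneg hb]
    refine (hmono (R.singularValues_nonneg j) (Set.mem_Ici.mpr (by positivity)) h1).trans ?_
    exact hh.2 (norm_nonneg _) (norm_nonneg _) ha hb hab
  calc _ ≤ ∑ j, (a * h ‖inner 𝕜 (u j) (S (v j))‖ + b * h ‖inner 𝕜 (u j) (T (v j))‖) :=
        Finset.sum_le_sum fun j _ => key j
    _ = a * ∑ j, h ‖inner 𝕜 (u j) (S (v j))‖ + b * ∑ j, h ‖inner 𝕜 (u j) (T (v j))‖ := by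
        rw [Finset.sum_add_distrib, Finset.mul_sum, Finset.mul_sum]
    _ ≤ _ := add_le_add
        (mul_le_mul_of_nonneg_left
          (sum_map_norm_inner_le_sum_singularValues S hn hh h0 hpos v hu1 hu) ha)
        (mul_le_mul_of_nonneg_left
          (sum_map_norm_inner_le_sum_singularValues T hn hh h0 hpos v hu1 hu) hb)

/-- Both sides are the trace of `T* T`, in its eigenbasis and in `e`. -/
theorem sum_sq_singularValues (T : E →ₗ[𝕜] F) {n : ℕ} (hn : finrank 𝕜 E = n)
    {ι : Type*} [Fintype ι] (e : OrthonormalBasis ι 𝕜 E) :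
    ∑ k : Fin n, T.singularValues k ^ 2 = ∑ i, ‖T (e i)‖ ^ 2 := by
  have key : ∀ x, inner 𝕜 x ((LinearMap.adjoint T ∘ₗ T) x) = ((‖T x‖ ^ 2 : ℝ) : 𝕜) := fun x => by
    rw [LinearMap.comp_apply, LinearMap.adjoint_inner_right, inner_self_eq_norm_sq_to_K]
    push_cast
    rfl
  have h1 := LinearMap.trace_eq_sum_inner (LinearMap.adjoint T ∘ₗ T) e
  rw [LinearMap.trace_eq_sum_inner (LinearMap.adjoint T ∘ₗ T)
    (T.isSymmetric_adjoint_comp_self.eigenvectorBasis hn)] at h1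
  simp_rw [LinearMap.IsSymmetric.apply_eigenvectorBasis, inner_smul_right,
    OrthonormalBasis.inner_eq_one, mul_one, key, ← T.sq_singularValues_fin hn] at h1
  exact_mod_cast h1

end SingularValues

/-! ### The spectral penalty of a matrix -/

section MatrixPenalty

open Module

variable {p q : ℕ}

theorem singularValues_eq_zero_of_min_le (A : Matrix (Fin p) (Fin q) ℂ) {j : ℕ}
    (hj : min p q ≤ j) : (Matrix.toEuclideanLin A).singularValues j = 0 := by
  rw [LinearMap.singularValues_eq_zero_iff_le_finrank_range]
  refine le_trans (le_min ?_ ?_) hj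
  · simpa using Submodule.finrank_le (LinearMap.range (Matrix.toEuclideanLin A))
  · simpa using LinearMap.finrank_range_le (Matrix.toEuclideanLin A)

theorem matrixPenalty_eq_sum_fin {h : ℝ → ℝ} (h0 : h 0 = 0) (A : Matrix (Fin p) (Fin q) ℂ) :
    matrixPenalty h A = ∑ k : Fin q, h ((Matrix.toEuclideanLin A).singularValues k) := by
  rw [matrixPenalty, Fin.sum_univ_eq_sum_range
    (fun j => h ((Matrix.toEuclideanLin A).singularValues j))]
  refine Finset.sum_subset (Finset.range_mono (min_le_right p q)) fun j _ hj => ?_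
  rw [singularValues_eq_zero_of_min_le A (by simpa only [Finset.mem_range, not_lt] using hj), h0]

theorem convexOn_matrixPenalty {g : ℝ → ℝ} (hg : ConvexOn ℝ (Set.Ici 0) g)
    (hg0 : ∀ x, 0 ≤ x → g 0 ≤ g x) :
    ConvexOn ℝ Set.univ (matrixPenalty g : Matrix (Fin p) (Fin q) ℂ → ℝ) := by
  -- Normalising to `h 0 = 0` lets the sum run over all `q` indices, the extra singular values being
  -- zero.
  set h : ℝ → ℝ := fun x => g x - g 0 with hh
  have hconv : ConvexOn ℝ (Set.Ici 0) h := by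
    have := hg.add_const (-g 0)
    rwa [show g + (fun _ => -g 0) = h from funext fun x => (sub_eq_add_neg _ _).symm] at this
  have h0 : h 0 = 0 := sub_self _
  have heq : ∀ A : Matrix (Fin p) (Fin q) ℂ, matrixPenalty g A =
      ∑ k : Fin q, h ((Matrix.toEuclideanLin A).singularValues k) + (min p q : ℕ) * g 0 := by
    intro A
    rw [← matrixPenalty_eq_sum_fin h0]
    simp [matrixPenalty, hh]
  refine ⟨convex_univ, fun A _ B _ a b ha hb hab => ?_⟩
  have h1 := sum_map_singularValues_convex (n := q) (by simp) hconv h0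
    (fun x hx => sub_nonneg.mpr (hg0 x hx)) (Matrix.toEuclideanLin A) (Matrix.toEuclideanLin B)
    ha hb hab
  have h2 : Matrix.toEuclideanLin (a • A + b • B) =
      (a : ℂ) • Matrix.toEuclideanLin A + (b : ℂ) • Matrix.toEuclideanLin B := by
    rw [← map_smul, ← map_smul, ← map_add]
    rfl
  rw [heq, heq, heq, h2, smul_eq_mul, smul_eq_mul]
  have h3 : ((min p q : ℕ) : ℝ) * g 0 = (a + b) * ((min p q : ℕ) * g 0) := by rw [hab, one_mul]
  refine (add_le_add_left h1 _).trans ?_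
  linarith

theorem matrixPenalty_sq (A : Matrix (Fin p) (Fin q) ℂ) :
    matrixPenalty (fun x => x ^ 2) A = ∑ i, ∑ j, ‖A i j‖ ^ 2 := by
  rw [matrixPenalty_eq_sum_fin (by simp),
    sum_sq_singularValues _ (by simp) (EuclideanSpace.basisFun (Fin q) ℂ), Finset.sum_comm]
  refine Finset.sum_congr rfl fun j _ => ?_
  rw [EuclideanSpace.norm_sq_eq]
  simp

theorem matrixPenalty_add_mul_sq (f : ℝ → ℝ) (c : ℝ) (A : Matrix (Fin p) (Fin q) ℂ) :
    matrixPenalty (fun x => f x + c * x ^ 2) A =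
      matrixPenalty f A + c * ∑ i, ∑ j, ‖A i j‖ ^ 2 := by
  rw [← matrixPenalty_sq]
  simp only [matrixPenalty, Finset.sum_add_distrib, Finset.mul_sum]

theorem matrixPenalty_nonneg {f : ℝ → ℝ} (hf : ∀ x, 0 ≤ x → 0 ≤ f x)
    (A : Matrix (Fin p) (Fin q) ℂ) : 0 ≤ matrixPenalty f A :=
  Finset.sum_nonneg fun j _ => hf _ (LinearMap.singularValues_nonneg _ j)

end MatrixPenalty

theorem convexOn_univ_sum {V ι : Type*} [AddCommGroup V] [Module ℝ V] (s : Finset ι)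
    {F : ι → V → ℝ} (hF : ∀ i ∈ s, ConvexOn ℝ Set.univ (F i)) :
    ConvexOn ℝ Set.univ fun x => ∑ i ∈ s, F i x := by
  refine ⟨convex_univ, fun x hx y hy a b ha hb hab => ?_⟩
  simp only [smul_eq_mul, Finset.mul_sum, ← Finset.sum_add_distrib]
  exact Finset.sum_le_sum fun i hi => (hF i hi).2 hx hy ha hb hab

/-! ### Frobenius norms under mode products -/

section ModeProduct

variable {R : Type*} {N : ℕ} {n : Fin N → ℕ}

theorem modeProduct_add [CommSemiring R] (d : Fin N) (F : Matrix (Fin (n d)) (Fin (n d)) R)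
    (A B : TensorIndex n → R) :
    modeProduct d F (A + B) = modeProduct d F A + modeProduct d F B := by
  ext i
  simp [modeProduct, mul_add, Finset.sum_add_distrib]

theorem modeProduct_smul [CommSemiring R] (d : Fin N) (F : Matrix (Fin (n d)) (Fin (n d)) R)
    (c : R) (A : TensorIndex n → R) : modeProduct d F (c • A) = c • modeProduct d F A := by
  ext i
  simp [modeProduct, Finset.mul_sum, mul_left_comm]

/-- Along the mode-`d` fibers a mode product is just a matrix acting on vectors, so norm bounds
reduce to one matrix. -/
theorem sum_eq_sum_fiber (d : Fin N) (φ : TensorIndex n → ℝ) :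
    ∑ i, φ i = ∑ r : (j : {j // j ≠ d}) → Fin (n j), ∑ a : Fin (n d),
      φ ((Equiv.piSplitAt d fun j => Fin (n j)).symm (a, r)) := by
  rw [← Equiv.sum_comp (Equiv.piSplitAt d fun j => Fin (n j)).symm, Fintype.sum_prod_type_right]

theorem modeProduct_fiber [CommSemiring R] (d : Fin N) (F : Matrix (Fin (n d)) (Fin (n d)) R)
    (A : TensorIndex n → R) (a : Fin (n d)) (r : (j : {j // j ≠ d}) → Fin (n j)) :
    modeProduct d F A ((Equiv.piSplitAt d fun j => Fin (n j)).symm (a, r)) =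
      F.mulVec (fun k => A ((Equiv.piSplitAt d fun j => Fin (n j)).symm (k, r))) a := by
  have h1 : (Equiv.piSplitAt d fun j => Fin (n j)).symm (a, r) d = a := by
    simp [Equiv.piSplitAt]
  have h2 : ∀ k, Function.update ((Equiv.piSplitAt d fun j => Fin (n j)).symm (a, r)) d k =
      (Equiv.piSplitAt d fun j => Fin (n j)).symm (k, r) := by
    intro k
    ext j
    by_cases hj : j = d
    · subst hj
      simp [Equiv.piSplitAt]
    · simp [Equiv.piSplitAt, hj]
  simp only [modeProduct, h1, h2, Matrix.mulVec, dotProduct]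

theorem sum_norm_sq_modeProduct_le [NormedField R] (d : Fin N)
    {F : Matrix (Fin (n d)) (Fin (n d)) R} {c : ℝ}
    (hF : ∀ x, ∑ a, ‖F.mulVec x a‖ ^ 2 ≤ c * ∑ a, ‖x a‖ ^ 2) (A : TensorIndex n → R) :
    ∑ i, ‖modeProduct d F A i‖ ^ 2 ≤ c * ∑ i, ‖A i‖ ^ 2 := by
  rw [sum_eq_sum_fiber d, sum_eq_sum_fiber d (fun i => ‖A i‖ ^ 2), Finset.mul_sum]
  simp_rw [modeProduct_fiber]
  exact Finset.sum_le_sum fun r _ => hF _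

theorem sum_norm_sq_modeProduct_eq [NormedField R] (d : Fin N)
    {F : Matrix (Fin (n d)) (Fin (n d)) R} {c : ℝ}
    (hF : ∀ x, ∑ a, ‖F.mulVec x a‖ ^ 2 = c * ∑ a, ‖x a‖ ^ 2) (A : TensorIndex n → R) :
    ∑ i, ‖modeProduct d F A i‖ ^ 2 = c * ∑ i, ‖A i‖ ^ 2 := by
  rw [sum_eq_sum_fiber d, sum_eq_sum_fiber d (fun i => ‖A i‖ ^ 2), Finset.mul_sum]
  simp_rw [modeProduct_fiber]
  exact Finset.sum_congr rfl fun r _ => hF _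

theorem sum_norm_sq_mulVec_smul_unitary {m : ℕ} {W : Matrix (Fin m) (Fin m) ℂ}
    (hW : W ∈ Matrix.unitaryGroup (Fin m) ℂ) (c : ℝ) (x : Fin m → ℂ) :
    ∑ a, ‖((c : ℂ) • W).mulVec x a‖ ^ 2 = c ^ 2 * ∑ a, ‖x a‖ ^ 2 := by
  have key : ∀ y : Fin m → ℂ, ((∑ a, ‖y a‖ ^ 2 : ℝ) : ℂ) = star y ⬝ᵥ y := by
    intro y
    simp [dotProduct, Complex.conj_mul']
  have h1 : ∑ a, ‖W.mulVec x a‖ ^ 2 = ∑ a, ‖x a‖ ^ 2 := by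
    have : star (W.mulVec x) ⬝ᵥ W.mulVec x = star x ⬝ᵥ x := by
      rw [Matrix.star_mulVec, Matrix.dotProduct_mulVec, Matrix.vecMul_vecMul,
        ← Matrix.star_eq_conjTranspose, Matrix.mem_unitaryGroup_iff'.mp hW, Matrix.vecMul_one]
    rw [← key, ← key] at this
    exact_mod_cast this
  simp_rw [Matrix.smul_mulVec, Pi.smul_apply, norm_smul, mul_pow]
  rw [← Finset.mul_sum, h1]
  simp

/-- The matrix is a cyclic shift minus the identity; use `(s - t)^2 ≤ 2s^2 + 2t^2` and the shift
invariance of the sum. -/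
theorem sum_norm_sq_mulVec_differenceMatrix_le {m : ℕ} (x : Fin m → ℝ) :
    ∑ a, ‖(differenceMatrix m).mulVec x a‖ ^ 2 ≤ 4 * ∑ a, ‖x a‖ ^ 2 := by
  have h1 : ∀ a, (differenceMatrix m).mulVec x a = x (finRotate m a) - x a := by
    intro a
    simp [differenceMatrix, Matrix.mulVec, dotProduct, sub_mul, Finset.sum_sub_distrib]
  calc ∑ a, ‖(differenceMatrix m).mulVec x a‖ ^ 2
      ≤ ∑ a, (2 * ‖x (finRotate m a)‖ ^ 2 + 2 * ‖x a‖ ^ 2) := by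
        refine Finset.sum_le_sum fun a _ => ?_
        rw [h1]
        simp only [Real.norm_eq_abs, sq_abs]
        nlinarith [sq_nonneg (x (finRotate m a) + x a)]
    _ = 4 * ∑ a, ‖x a‖ ^ 2 := by
        rw [Finset.sum_add_distrib, ← Finset.mul_sum, ← Finset.mul_sum,
          Equiv.sum_comp (finRotate m) fun a => ‖x a‖ ^ 2]
        ring

end ModeProduct

/-! ### The gradient as a bounded linear map -/

section Gradient

variable {N : ℕ} {n : Fin N → ℕ}

/-- The gradient along a mode, as a linear map. -/
def tensorGradLinear (d : Fin N) : TensorSpace n →ₗ[ℝ] TensorSpace n where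
  toFun := tensorGrad d
  map_add' A B := by
    simp only [tensorGrad, WithLp.ofLp_add, modeProduct_add, WithLp.toLp_add]
  map_smul' c A := by
    simp only [tensorGrad, WithLp.ofLp_smul, modeProduct_smul, WithLp.toLp_smul, RingHom.id_apply]

theorem norm_sq_tensorGrad_le (d : Fin N) (A : TensorSpace n) :
    ‖tensorGrad d A‖ ^ 2 ≤ 4 * ‖A‖ ^ 2 := by
  rw [EuclideanSpace.norm_sq_eq, EuclideanSpace.norm_sq_eq]
  exact sum_norm_sq_modeProduct_le d sum_norm_sq_mulVec_differenceMatrix_le _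

end Gradient

/-- The convexity gap of this quadratic form is `a * b` times its value at `x - y`, which is
nonnegative. -/
theorem convexOn_mul_norm_sq_sub_norm_sq {V W : Type*} [NormedAddCommGroup V]
    [InnerProductSpace ℝ V] [NormedAddCommGroup W] [InnerProductSpace ℝ W] (G : V →ₗ[ℝ] W) {c : ℝ}
    (hG : ∀ x, ‖G x‖ ^ 2 ≤ c * ‖x‖ ^ 2) :
    ConvexOn ℝ Set.univ fun x => c * ‖x‖ ^ 2 - ‖G x‖ ^ 2 := by
  refine ⟨convex_univ, fun x _ y _ a b ha hb hab => ?_⟩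
  have h1 := mul_nonneg (mul_nonneg ha hb) (sub_nonneg.mpr (hG (x - y)))
  rw [map_sub, norm_sub_sq_real, norm_sub_sq_real] at h1
  simp only [map_add, map_smul, norm_add_sq_real, norm_smul, mul_pow, real_inner_smul_left,
    real_inner_smul_right, smul_eq_mul, Real.norm_eq_abs, sq_abs]
  obtain rfl : b = 1 - a := by linarith
  linarith

/-! ### Weak convexity of the total variation -/

section Penalty

variable {M : ℕ} {n : Fin (M + 3) → ℕ}
  {U : (j : Fin (M + 1)) → Matrix (Fin (n j.succ.succ)) (Fin (n j.succ.succ)) ℂ}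

theorem foldl_modeProduct_add (L : List (Fin (M + 1))) (A B : TensorIndex n → ℂ) :
    L.foldl (fun B j => modeProduct j.succ.succ (U j) B) (A + B) =
      L.foldl (fun B j => modeProduct j.succ.succ (U j) B) A +
        L.foldl (fun B j => modeProduct j.succ.succ (U j) B) B := by
  induction L generalizing A B with
  | nil => rfl
  | cons j L ih => simp only [List.foldl_cons, modeProduct_add, ih]

theorem foldl_modeProduct_smul (L : List (Fin (M + 1))) (c : ℂ) (A : TensorIndex n → ℂ) :
    L.foldl (fun B j => modeProduct j.succ.succ (U j) B) (c • A) =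
      c • L.foldl (fun B j => modeProduct j.succ.succ (U j) B) A := by
  induction L generalizing A with
  | nil => rfl
  | cons j L ih => simp only [List.foldl_cons, modeProduct_smul, ih]

/-- The face slices of the transform of a real tensor depend linearly on the tensor. -/
def transformSliceLinear
    (U : (j : Fin (M + 1)) → Matrix (Fin (n j.succ.succ)) (Fin (n j.succ.succ)) ℂ)
    (r : (j : Fin (M + 1)) → Fin (n j.succ.succ)) :
    TensorSpace n →ₗ[ℝ] Matrix (Fin (n 0)) (Fin (n 1)) ℂ where
  toFun A := faceSlice (tensorTransform U (fun i => (A i : ℂ))) r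
  map_add' A B := by
    have : (fun i => (((A + B) i : ℝ) : ℂ)) = (fun i => (A i : ℂ)) + fun i => (B i : ℂ) := by
      ext i; simp
    rw [this, tensorTransform, foldl_modeProduct_add]
    rfl
  map_smul' c A := by
    have : (fun i => (((c • A) i : ℝ) : ℂ)) = (c : ℂ) • fun i => (A i : ℂ) := by
      ext i; simp
    rw [this, tensorTransform, foldl_modeProduct_smul]
    ext a b
    simp [faceSlice, tensorTransform]

variable {l : Fin (M + 1) → ℝ}

theorem sum_norm_sq_tensorTransform
    (hU : ∀ j, ∃ W : Matrix (Fin (n j.succ.succ)) (Fin (n j.succ.succ)) ℂ,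
      W ∈ Matrix.unitaryGroup (Fin (n j.succ.succ)) ℂ ∧ U j = (l j : ℂ) • W)
    (A : TensorIndex n → ℂ) :
    ∑ i, ‖tensorTransform U A i‖ ^ 2 = (∏ j, l j) ^ 2 * ∑ i, ‖A i‖ ^ 2 := by
  have key : ∀ (L : List (Fin (M + 1))) (A : TensorIndex n → ℂ),
      ∑ i, ‖L.foldl (fun B j => modeProduct j.succ.succ (U j) B) A i‖ ^ 2 =
        ((L.map l).prod) ^ 2 * ∑ i, ‖A i‖ ^ 2 := by
    intro L
    induction L with
    | nil => simp
    | cons j L ih =>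
      intro A
      obtain ⟨W, hW, hUj⟩ := hU j
      rw [List.foldl_cons, ih, hUj,
        sum_norm_sq_modeProduct_eq j.succ.succ (sum_norm_sq_mulVec_smul_unitary hW (l j)),
        List.map_cons, List.prod_cons]
      ring
  rw [tensorTransform, key, Fin.prod_univ_def]

theorem sum_norm_sq_faceSlice (A : TensorIndex n → ℂ) :
    ∑ r : (j : Fin (M + 1)) → Fin (n j.succ.succ), ∑ a, ∑ b, ‖faceSlice A r a b‖ ^ 2 =
      ∑ i, ‖A i‖ ^ 2 := by
  rw [← Equiv.sum_comp (Fin.consEquiv fun d => Fin (n d)) fun i => ‖A i‖ ^ 2,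
    Fintype.sum_prod_type, Finset.sum_comm]
  refine Finset.sum_congr rfl fun a _ => ?_
  rw [← Equiv.sum_comp (Fin.consEquiv fun d : Fin (M + 2) => Fin (n d.succ)),
    Fintype.sum_prod_type, Finset.sum_comm]
  rfl

/-- The prefactor `1 / l^2` exactly cancels the factor `l^2` from the scaled unitary transforms. -/
theorem tensorPenalty_add_mul_sq (hl : ∀ j, 0 < l j)
    (hU : ∀ j, ∃ W : Matrix (Fin (n j.succ.succ)) (Fin (n j.succ.succ)) ℂ,
      W ∈ Matrix.unitaryGroup (Fin (n j.succ.succ)) ℂ ∧ U j = (l j : ℂ) • W)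
    (f : ℝ → ℝ) (c : ℝ) (A : TensorSpace n) :
    tensorPenalty (fun x => f x + c * x ^ 2) U l A = tensorPenalty f U l A + c * ‖A‖ ^ 2 := by
  have hprod : ∏ j, l j ≠ 0 := (Finset.prod_pos fun j _ => hl j).ne'
  simp only [tensorPenalty, matrixPenalty_add_mul_sq, Finset.sum_add_distrib, ← Finset.mul_sum,
    sum_norm_sq_faceSlice, sum_norm_sq_tensorTransform hU, EuclideanSpace.norm_sq_eq]
  simp only [Complex.norm_real]
  field_simp

theorem convexOn_tensorPenalty {g : ℝ → ℝ} (hg : ConvexOn ℝ (Set.Ici 0) g)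
    (hg0 : ∀ x, 0 ≤ x → g 0 ≤ g x) : ConvexOn ℝ Set.univ (tensorPenalty g U l) := by
  have h1 : ConvexOn ℝ Set.univ fun A : TensorSpace n =>
      ∑ r : (j : Fin (M + 1)) → Fin (n j.succ.succ),
        matrixPenalty g (transformSliceLinear U r A) :=
    convexOn_univ_sum _ fun r _ =>
      (convexOn_matrixPenalty hg hg0).comp_linearMap (transformSliceLinear U r)
  exact h1.smul (c := 1 / (∏ j, l j) ^ 2) (by positivity)

theorem tensorPenalty_nonneg {f : ℝ → ℝ} (hf : ∀ x, 0 ≤ x → 0 ≤ f x) (A : TensorSpace n) :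
    0 ≤ tensorPenalty f U l A :=
  mul_nonneg (by positivity) (Finset.sum_nonneg fun _ _ => matrixPenalty_nonneg hf _)

theorem gtctv_nonneg {f : ℝ → ℝ} (hf : ∀ x, 0 ≤ x → 0 ≤ f x) (Γ : Finset (Fin (M + 3)))
    (A : TensorSpace n) : 0 ≤ gtctv f U l Γ A :=
  mul_nonneg (by positivity) (Finset.sum_nonneg fun _ _ => tensorPenalty_nonneg hf _)

/-- The generalized tensor correlated total variation is `4 μ`-weakly convex. -/
theorem convexOn_gtctv_add (hl : ∀ j, 0 < l j)
    (hU : ∀ j, ∃ W : Matrix (Fin (n j.succ.succ)) (Fin (n j.succ.succ)) ℂ,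
      W ∈ Matrix.unitaryGroup (Fin (n j.succ.succ)) ℂ ∧ U j = (l j : ℂ) • W)
    {f : ℝ → ℝ} {μ : ℝ} (hμ : 0 ≤ μ) (hf_conv : WeaklyConvexOn (Set.Ici 0) μ f)
    (hf_zero : ∀ x, 0 ≤ x → f 0 ≤ f x) {Γ : Finset (Fin (M + 3))} (hΓ : Γ.Nonempty) :
    ConvexOn ℝ Set.univ fun X : TensorSpace n => gtctv f U l Γ X + 2 * μ * ‖X‖ ^ 2 := by
  have hg : ConvexOn ℝ (Set.Ici 0) fun x => f x + μ / 2 * x ^ 2 := by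
    simpa only [WeaklyConvexOn, Real.norm_eq_abs, sq_abs] using hf_conv
  have hg0 : ∀ x, 0 ≤ x → f 0 + μ / 2 * 0 ^ 2 ≤ f x + μ / 2 * x ^ 2 := fun x hx => by
    have := hf_zero x hx
    have : 0 ≤ μ / 2 * x ^ 2 := by positivity
    linarith
  have hcard : (Γ.card : ℝ) ≠ 0 := by exact_mod_cast hΓ.card_pos.ne'
  -- Here `2μ = (μ/2) * 4`: one part of the quadratic term convexifies the penalty of the gradient,
  -- and the remainder is a nonnegative quadratic form.
  have heq : ∀ X : TensorSpace n, gtctv f U l Γ X + 2 * μ * ‖X‖ ^ 2 =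
      1 / (Γ.card : ℝ) * ∑ d ∈ Γ, (tensorPenalty (fun x => f x + μ / 2 * x ^ 2) U l
        (tensorGradLinear d X) + μ / 2 * (4 * ‖X‖ ^ 2 - ‖tensorGradLinear d X‖ ^ 2)) := by
    intro X
    have : ∀ d, tensorPenalty (fun x => f x + μ / 2 * x ^ 2) U l
        (tensorGradLinear d X) + μ / 2 * (4 * ‖X‖ ^ 2 - ‖tensorGradLinear d X‖ ^ 2) =
          tensorPenalty f U l (tensorGrad d X) + 2 * μ * ‖X‖ ^ 2 := by
      intro d
      rw [tensorPenalty_add_mul_sq hl hU]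
      change tensorPenalty f U l (tensorGrad d X) + μ / 2 * ‖tensorGrad d X‖ ^ 2 +
        μ / 2 * (4 * ‖X‖ ^ 2 - ‖tensorGrad d X‖ ^ 2) = _
      ring
    simp_rw [this]
    rw [Finset.sum_add_distrib, Finset.sum_const, nsmul_eq_mul, gtctv]
    field_simp
  simp_rw [heq]
  refine (convexOn_univ_sum Γ fun d _ => ?_).smul
    (c := 1 / (Γ.card : ℝ)) (by positivity)
  exact ((convexOn_tensorPenalty hg hg0).comp_linearMap (tensorGradLinear d)).add
    ((convexOn_mul_norm_sq_sub_norm_sq (tensorGradLinear d) (norm_sq_tensorGrad_le d)).smul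
      (c := μ / 2) (by positivity))

end Penalty

/-! ### The normal cone of the data constraint -/

section DataIndicator

variable {N : ℕ} {n : Fin N → ℕ} {Y : TensorSpace n} {Ω : Finset (TensorIndex n)}

/-- Testing at the feasible point `Y` excludes subgradients at infeasible points; elsewhere the
subdifferential is a normal cone. -/
theorem mem_opA_iff {x u : TensorSpace n} : u ∈ opA Y Ω x ↔ tensorProj Ω x = tensorProj Ω Y ∧
    ∀ y, tensorProj Ω y = tensorProj Ω Y → inner ℝ (y - x) u ≤ 0 := by
  simp only [opA, subdifferential, Set.mem_ofPred_eq]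
  constructor
  · intro h
    have hx : tensorProj Ω x = tensorProj Ω Y := by
      by_contra hx
      have := h Y
      rw [dataIndicator, dataIndicator, if_neg hx, if_pos rfl, EReal.coe_add_top] at this
      exact absurd this (by simp)
    refine ⟨hx, fun y hy => ?_⟩
    have := h y
    rw [dataIndicator, dataIndicator, if_pos hx, if_pos hy, add_zero] at this
    exact_mod_cast this
  · rintro ⟨hx, h⟩ y
    rw [dataIndicator, dataIndicator, if_pos hx, add_zero]
    split_ifs with hy
    · exact_mod_cast h y hy
    · exact le_top

theorem isMonotoneOperator_opA (Y : TensorSpace n) (Ω : Finset (TensorIndex n)) :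
    IsMonotoneOperator (opA Y Ω) := by
  intro x y u v hu hv
  rw [mem_opA_iff] at hu hv
  have h1 := hu.2 y hv.1
  have h2 := hv.2 x hu.1
  have h3 : inner ℝ (y - x) u = -inner ℝ (x - y) u := by rw [← inner_neg_left, neg_sub]
  rw [inner_sub_right]
  linarith

theorem tensorProj_eq_iff {X X' : TensorSpace n} :
    tensorProj Ω X = tensorProj Ω X' ↔ ∀ i ∈ Ω, X i = X' i := by
  constructor
  · intro h i hi
    have := congrArg (fun Z : TensorSpace n => Z i) h
    simpa [tensorProj, hi] using this
  · intro h
    ext i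
    by_cases hi : i ∈ Ω
    · simp [tensorProj, hi, h i hi]
    · simp [tensorProj, hi]

/-- The resolvent of `∂ δ_{Y, Ω}` is the projection to the data constraint. -/
theorem tensorProj_compl_add_mem_setResolvent_opA {τ : ℝ} (hτ : 0 < τ) (X : TensorSpace n) :
    tensorProj Ωᶜ X + tensorProj Ω Y ∈ setResolvent τ (opA Y Ω) X := by
  set p := tensorProj Ωᶜ X + tensorProj Ω Y with hp
  have hin : ∀ i ∈ Ω, p i = Y i := fun i hi => by simp [hp, tensorProj, hi]
  have hout : ∀ i ∉ Ω, p i = X i := fun i hi => by simp [hp, tensorProj, hi]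
  refine ⟨τ⁻¹ • (X - p), mem_opA_iff.mpr ⟨tensorProj_eq_iff.mpr hin, fun y hy => ?_⟩, ?_⟩
  · rw [real_inner_smul_right, PiLp.inner_apply, Finset.sum_eq_zero, mul_zero]
    intro i _
    by_cases hi : i ∈ Ω
    · simp [hin i hi, tensorProj_eq_iff.mp hy i hi]
    · simp [hout i hi]
  · rw [smul_smul, mul_inv_cancel₀ hτ.ne', one_smul]; abel

end DataIndicator

end

/-! ### Convergence of the algorithm -/

theorem corollary1
    -- the space of real tensors of order `M + 3` with dimensions `n`
    {M : ℕ} (n : Fin (M + 3) → ℕ)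
    -- the scaled unitary transform matrices of the modes from the third on
    (U : (j : Fin (M + 1)) → Matrix (Fin (n j.succ.succ)) (Fin (n j.succ.succ)) ℂ)
    (l : Fin (M + 1) → ℝ) (hl : ∀ j, 0 < l j)
    (hU : ∀ j, ∃ W : Matrix (Fin (n j.succ.succ)) (Fin (n j.succ.succ)) ℂ,
      W ∈ Matrix.unitaryGroup (Fin (n j.succ.succ)) ℂ ∧ U j = (l j : ℂ) • W)
    -- the penalty, of which only the values on `[0, ∞)` matter
    (f : ℝ → ℝ) (μ : ℝ) (hμ : 0 ≤ μ) (hf_nonneg : ∀ x, 0 ≤ x → 0 ≤ f x)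
    (hf_conv : WeaklyConvexOn (Set.Ici 0) μ f) (hf_zero : ∀ x, 0 ≤ x → f 0 ≤ f x)
    -- gradient directions, observation, denoiser
    (Γ : Finset (Fin (M + 3))) (hΓ : Γ.Nonempty)
    (Y : TensorSpace n) (Ω : Finset (TensorIndex n))
    (k : ℝ) (hk : k ∈ Set.Ioo (0 : ℝ) 1)
    (D : TensorSpace n → TensorSpace n) (hD : IsPseudoContractive k D)
    (α : ℝ) (hα : 0 < α)
    -- the inclusion is solvable
    (hsol : (inclusionSolutions (opA Y Ω) (opB f μ U l Γ) (opC α D)).Nonempty)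
    -- step size and relaxation parameters
    (τ : ℝ) (hτ : τ ∈ Set.Ioo (0 : ℝ) ((2 - 2 * k) / α))
    (lam : ℕ → ℝ) (hlam : ∀ t, lam t ∈ Set.Icc (0 : ℝ) 1)
    (hlam_sum : Tendsto (fun m => ∑ t ∈ Finset.range m, lam t) atTop atTop)
    (hlam_sq : Summable (fun t => lam t ^ 2))
    -- the iterates of the algorithm, with an arbitrary starting point `Z 0`
    (Z XB XA : ℕ → TensorSpace n)
    (hXB : ∀ t, XB (t + 1) = resolventMap τ (opB f μ U l Γ) (Z t))
    (hXA : ∀ t, XA (t + 1) =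
      tensorProj Ωᶜ ((2 : ℝ) • XB (t + 1) - Z t - (τ * α) • (XB (t + 1) - D (XB (t + 1))))
        + tensorProj Ω Y)
    (hZ : ∀ t, Z (t + 1) = Z t + lam t • (XA (t + 1) - XB (t + 1))) :
    -- both resolvents are single-valued with full domain, so that the operator `T` is well defined
    (∀ X, setResolvent τ (opA Y Ω) X = {resolventMap τ (opA Y Ω) X}) ∧
    (∀ X, setResolvent τ (opB f μ U l Γ) X = {resolventMap τ (opB f μ U l Γ) X}) ∧
    -- the algorithm is the Davis–Yin splitting, relaxed
    (∀ t, XA (t + 1) = resolventMap τ (opA Y Ω)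
      ((2 : ℝ) • XB (t + 1) - Z t - τ • opC α D (XB (t + 1)))) ∧
    (∀ t, Z (t + 1) = (1 - lam t) • Z t +
      lam t • davisYin τ (opA Y Ω) (opB f μ U l Γ) (opC α D) (Z t)) ∧
    -- convergence
    (∃ z, davisYin τ (opA Y Ω) (opB f μ U l Γ) (opC α D) z = z ∧ Tendsto Z atTop (𝓝 z)) ∧
    (∃ X ∈ inclusionSolutions (opA Y Ω) (opB f μ U l Γ) (opC α D),
      Tendsto XB atTop (𝓝 X) ∧ Tendsto XA atTop (𝓝 X)) := by
  set A := opA Y Ω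
  set B := opB f μ U l Γ
  set C := opC α D
  have hτ0 : 0 < τ := hτ.1
  have hA : IsMonotoneOperator A := isMonotoneOperator_opA Y Ω
  have hB : IsMonotoneOperator B := isMonotoneOperator_subdifferential_coe _
  have hresA : ∀ X, setResolvent τ A X = {resolventMap τ A X} := fun X =>
    setResolvent_eq_singleton hA hτ0 ⟨_, tensorProj_compl_add_mem_setResolvent_opA hτ0 X⟩
  have hresB : ∀ X, setResolvent τ B X = {resolventMap τ B X} := fun X =>
    setResolvent_eq_singleton hB hτ0 (setResolvent_subdifferential_coe_nonempty
      (convexOn_gtctv_add hl hU hμ hf_conv hf_zero hΓ)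
      (fun X => add_nonneg (gtctv_nonneg hf_nonneg Γ X) (by positivity)) hτ0 X)
  have hXA' : ∀ t, XA (t + 1) =
      resolventMap τ A ((2 : ℝ) • XB (t + 1) - Z t - τ • C (XB (t + 1))) := by
    intro t
    rw [resolventMap_eq_of_mem (hresA _) (tensorProj_compl_add_mem_setResolvent_opA hτ0 _), hXA,
      mul_smul]
    rfl
  have hT : ∀ t, Z t - davisYin τ A B C (Z t) = XB (t + 1) - XA (t + 1) := by
    intro t
    rw [hXA', davisYin, ← hXB]
    abel
  have hZT : ∀ t, Z (t + 1) = Z t - lam t • (Z t - davisYin τ A B C (Z t)) := by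
    intro t
    rw [hT, hZ]
    module
  have hβ : 0 < (1 - k) / (2 * α) := div_pos (sub_pos.mpr hk.2) (by positivity)
  have hc : 0 < 1 - τ / (4 * ((1 - k) / (2 * α))) := by
    -- The bound on `τ` is exactly `4β`.
    have h4 : 4 * ((1 - k) / (2 * α)) = (2 - 2 * k) / α := by field_simp; ring
    rw [h4, sub_pos, div_lt_one (h4 ▸ by positivity)]
    exact hτ.2
  have hlam_zero : Tendsto lam atTop (𝓝 0) := by
    have h := (Real.continuous_sqrt.tendsto 0).comp hlam_sq.tendsto_atTop_zero
    rw [Real.sqrt_zero] at h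
    exact h.congr fun t => Real.sqrt_sq (hlam t).1
  obtain ⟨w, hw⟩ := exists_davisYin_eq hresA hresB hsol
  obtain ⟨hRcont, z, hz, hZz⟩ := tendsto_zero_of_cocoercive
    (R := fun z => z - davisYin τ A B C z) hc
    (cocoercive_sub_davisYin hA hB hτ0 hβ (hD.cocoercive_opC hα) hresA hresB)
    ⟨w, by rw [hw, sub_self]⟩ (fun t => (hlam t).1) hlam_sum hlam_zero hZT
  have hz' : davisYin τ A B C z = z := (sub_eq_zero.mp hz).symm
  have hXBlim : Tendsto XB atTop (𝓝 (resolventMap τ B z)) := by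
    -- The entries `XB 0` and `XA 0` are unconstrained, so limits are taken along `t + 1`.
    rw [← tendsto_add_atTop_iff_nat 1]
    simp_rw [hXB]
    exact ((continuous_resolventMap hB hτ0 hresB).tendsto z).comp hZz
  refine ⟨hresA, hresB, hXA', fun t => ?_, ⟨z, hz', hZz⟩, resolventMap τ B z,
    mem_inclusionSolutions_of_davisYin_eq hτ0 hresA hresB hz', hXBlim, ?_⟩
  · rw [hZT]; module
  · rw [← tendsto_add_atTop_iff_nat 1]
    -- `XA (t + 1)` is `XB (t + 1)` minus the residual at `Z t`, which tends to zero by continuity.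
    have h1 : Tendsto (fun t => XB (t + 1) - (Z t - davisYin τ A B C (Z t))) atTop
        (𝓝 (resolventMap τ B z - 0)) :=
      ((tendsto_add_atTop_iff_nat 1).mpr hXBlim).sub (hz ▸ (hRcont.tendsto z).comp hZz)
    rw [sub_zero] at h1
    refine h1.congr fun t => ?_
    rw [hT, sub_sub_cancel]
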